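/- Let $V=\mathbb{R}^2$ with the standard inner product $(\cdot,\cdot)$, and let $\alpha_1,\alpha_2$ be simple roots of a root system of type $A_2$ in $V$, of squared length $2$ and at angles $-\pi/6$ and $\pi/2$ with the positive $x$-axis; let $\tilde\alpha=\alpha_1+\alpha_2$. For $\alpha\in\{\alpha_1,\alpha_2,\tilde\alpha\}$ and $k\in\mathbb{Z}$ let $s_{\alpha,k}$ be the reflection of $V$ across the line $H_{\alpha,k}=\{v\in V\mid(\alpha,v)=k\}$. Let $W$ be the affine Weyl group of type $\tilde A_2$, that is, the group of affine transformations of $V$ generated by all $s_{\alpha,k}$, with simple reflections $s_0=s_{\tilde\alpha,1}$, $s_1=s_{\alpha_1,0}$, $s_2=s_{\alpha_2,0}$ and the corresponding length function $\ell$. The Bruhat order on $W$ is the partial order generated by the relations $x<rx$, where $r$ is a conjugate of a simple reflection and $\ell(x)<\ell(rx)$. Let $q$ be the center of the fundamental alcove $\{v\mid(\alpha_1,v)>0,\ (\alpha_2,v)>0,\ (\tilde\alpha,v)<1\}$, so that $xq$ is the alcove center of $x\in W$. The fundamental root strips are the three regions $\{v\mid 0\le(\alpha,v)\le 1\}$,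 $\alpha\in\{\alpha_1,\alpha_2,\tilde\alpha\}$. An element $w\in W$ is called spiral if $wq$ lies in a fundamental root strip. The chambers are the connected components of the complement of the union of the fundamental root strips. Let $w\in W$ be non-spiral, and let $\mathcal{C}$ be the chamber containing $wq$. Then there is exactly one choice of $\{\alpha,\beta,\gamma\}=\{\alpha_1,\alpha_2,\tilde\alpha\}$ and $i,j,k\in\{0,1\}$ such that $H_{\alpha,i}$ and $H_{\beta,j}$ are the lines that contain the two boundary rays of $\mathcal{C}$, the ray on $H_{\alpha,i}$ being counterclockwise from $wq$ as seen from the vertex of $\mathcal{C}$, and $H_{\gamma,k}$ is the nearer to $wq$ of the two lines $H_{\gamma,0}$, $H_{\gamma,1}$. Put $$w_0=w,\quad w_1=s_{\alpha,i}\,w,\quad w_5=s_{\beta,j}\,w,\quad w_3=s_{\gamma,k}\,w,\quad w_2=s_{\gamma,k}\,w_1,\quad w_4=s_{\gamma,k}\,w_5 .$$ Then $w_0q,w_1q,\dots,w_5q$ are, in counterclockwise order, the vertices of a non-degenerate convex hexagon $\mathcal{H}_w$, and $$\{x\in W\mid x\le w\}=\{x\in W\mid xq\text{ lies on or inside }\mathcal{H}_w\}.$$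 -/

import Mathlib

namespace AffineA2

noncomputable section

/-- The Euclidean plane. -/
abbrev V : Type := EuclideanSpace ℝ (Fin 2)

/-- The positive roots of the root system of type `A₂`: `root 1` and `root 2` are the simple roots
`α₁`, `α₂`, of squared length `2` and at angles `-π/6` and `π/2` with the positive `x`-axis, and
`root 0` is the highest root `α₁ + α₂`.  Since every root has squared length `2`, roots and coroots
coincide. -/
def root : Fin 3 → V :=
  ![!₂[√6 / 2, √2 / 2], !₂[√6 / 2, -(√2 / 2)], !₂[0, √2]]

theorem root_zero : root 0 = root 1 + root 2 := by
  ext i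
  fin_cases i <;> simp [root]
  ring

theorem inner_root_self (a : Fin 3) : innerₗ V (root a) (root a) = 2 := by
  rw [innerₗ_apply_apply, PiLp.inner_apply, Fin.sum_univ_two]
  fin_cases a <;> simp [root, div_pow] <;> norm_num

theorem inner_root_one_two : inner ℝ (root 1) (root 2) = -1 := by
  have h2 : √2 * √2 = 2 := Real.mul_self_sqrt (by norm_num)
  simp [root, PiLp.inner_apply, Fin.sum_univ_two]
  nlinarith

/-- The root hyperplane (a line) `H_{α,k} = {v | (α, v) = k}`.  As `H_{-α,k} = H_{α,-k}`, the
positive roots suffice to obtain all root hyperplanes. -/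
def hyperplane (a : Fin 3) (k : ℤ) : Set V := {v | inner ℝ (root a) v = (k : ℝ)}

/-- The affine reflection `s_{α,k}` across `H_{α,k}`: the linear reflection `s_α` followed by the
translation by `k α`. -/
def affRefl (a : Fin 3) (k : ℤ) : V ≃ᵃ[ℝ] V :=
  (Module.reflection (inner_root_self a)).toAffineEquiv.trans
    (AffineEquiv.constVAdd ℝ V ((k : ℝ) • root a))

theorem affRefl_apply (a : Fin 3) (k : ℤ) (v : V) :
    affRefl a k v = v - (inner ℝ (root a) v - (k : ℝ)) • root a := by
  simp [affRefl, Module.reflection_apply, innerₗ_apply_apply, sub_smul]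
  abel

/-- The affine Weyl group of type `Ã₂`: the group of affine transformations of the plane generated
by all the reflections `s_{α,k}`. -/
def W : Subgroup (V ≃ᵃ[ℝ] V) :=
  Subgroup.closure (Set.range fun p : Fin 3 × ℤ => affRefl p.1 p.2)

/-- The reflection `s_{α,k}` as an element of `W`. -/
def refl (a : Fin 3) (k : ℤ) : W :=
  ⟨affRefl a k, Subgroup.subset_closure ⟨(a, k), rfl⟩⟩

/-- The simple reflections `s₀ = s_{α₀,1}` (where `α₀` is the highest root), `s₁ = s_{α₁,0}` and
`s₂ = s_{α₂,0}`. -/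
def simple : Fin 3 → W := ![refl 0 1, refl 1 0, refl 2 0]

/-- The length of `w`: the least length of an expression of `w` as a product of simple
reflections. -/
def length (w : W) : ℕ := sInf {n | ∃ l : List (Fin 3), l.length = n ∧ (l.map simple).prod = w}

/-- The reflections of `W`: the conjugates of the simple reflections. -/
def IsReflection (r : W) : Prop := ∃ (u : W) (i : Fin 3), r = u * simple i * u⁻¹

/-- The Bruhat order on `W`: the partial order generated by the relations `x < r x`, where `r` is a
reflection with `ℓ(x) < ℓ(r x)`. -/
def BruhatLE : W → W → Prop :=
  Relation.ReflTransGen fun x y => ∃ r : W, IsReflection r ∧ y = r * x ∧ length x < length y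

/-- The center `q` of the fundamental alcove `{v | (α₁, v) > 0, (α₂, v) > 0, (α₀, v) < 1}`,
an equilateral triangle; see `inner_root_q`. -/
def q : V := (1 / 3 : ℝ) • root 0

/-- `q` lies inside the fundamental alcove, at the same distance from its three sides. -/
theorem inner_root_q :
    inner ℝ (root 1) q = 1 / 3 ∧ inner ℝ (root 2) q = 1 / 3 ∧ 1 - inner ℝ (root 0) q = 1 / 3 := by
  have h1 := inner_root_self 1
  have h2 := inner_root_self 2
  have h0 := inner_root_self 0
  have h12 := inner_root_one_two
  have h21 : inner ℝ (root 2) (root 1) = -1 := by rw [real_inner_comm, h12]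
  rw [innerₗ_apply_apply] at h0 h1 h2
  refine ⟨?_, ?_, ?_⟩
  · rw [q, inner_smul_right, root_zero, inner_add_right, h1, h12]; norm_num
  · rw [q, inner_smul_right, root_zero, inner_add_right, h21, h2]; norm_num
  · rw [q, inner_smul_right, h0]; norm_num

/-- The alcove center `w q`. -/
def center (w : W) : V := (w : V ≃ᵃ[ℝ] V) q

/-- The fundamental root strip `{v | 0 ≤ (α, v) ≤ 1}`. -/
def fundStrip (a : Fin 3) : Set V := {v | 0 ≤ inner ℝ (root a) v ∧ inner ℝ (root a) v ≤ 1}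

/-- `w` is spiral if its alcove belongs to one of the fundamental root strips. -/
def IsSpiral (w : W) : Prop := ∃ a, center w ∈ fundStrip a

/-- The chamber of a non-spiral element `w`: the connected component, containing the alcove center
of `w`, of the complement of the union of the fundamental root strips. -/
def chamber (w : W) : Set V := connectedComponentIn (⋃ a, fundStrip a)ᶜ (center w)

/-- `H_{α,k}` is a wall of the region `C`: the boundary of `C` contains a ray of `H_{α,k}`. -/
def IsWall (C : Set V) (a : Fin 3) (k : ℤ) : Prop :=
  ∃ p d : V, d ≠ 0 ∧ ∀ t : ℝ, 0 ≤ t → p + t • d ∈ frontier C ∩ hyperplane a k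

/-- The oriented area of the parallelogram spanned by two vectors; it is positive exactly when the
counterclockwise angle from the first to the second lies strictly between `0` and `π`. -/
def cross (u v : V) : ℝ := u 0 * v 1 - u 1 * v 0

/-- Names `H_{α,i}`, `H_{β,j}`, `H_{γ,k}` for three root hyperplanes. -/
@[ext]
structure Labels where
  α : Fin 3
  i : ℤ
  β : Fin 3
  j : ℤ
  γ : Fin 3
  k : ℤ

/-- The three hyperplanes attached to a non-spiral element `w`: `α`, `β`, `γ` are the three positive
roots in some order and `i, j, k ∈ {0, 1}`; `H_{α,i}` and `H_{β,j}` are the walls of the chamber of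
`w`, where the first is the one counterclockwise from `w` (as seen from the vertex `v` of the
chamber); `H_{γ,k}` is the nearer to `w` of `H_{γ,0}` and `H_{γ,1}`. -/
structure Labels.IsFor (d : Labels) (w : W) : Prop where
  α_ne_β : d.α ≠ d.β
  γ_ne_α : d.γ ≠ d.α
  γ_ne_β : d.γ ≠ d.β
  i_mem : d.i = 0 ∨ d.i = 1
  j_mem : d.j = 0 ∨ d.j = 1
  k_mem : d.k = 0 ∨ d.k = 1
  wall_α : IsWall (chamber w) d.α d.i
  wall_β : IsWall (chamber w) d.β d.j
  counterclockwise : ∃ v ∈ hyperplane d.α d.i ∩ hyperplane d.β d.j,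
    ∀ p ∈ frontier (chamber w) ∩ hyperplane d.α d.i, p ≠ v → 0 < cross (center w - v) (p - v)
  nearer : Metric.infDist (center w) (hyperplane d.γ d.k) <
    Metric.infDist (center w) (hyperplane d.γ (1 - d.k))

/-- The vertices `w₀ = w`, `w₁ = s_{α,i} w`, `w₂ = s_{γ,k} w₁`, `w₃ = s_{γ,k} w`,
`w₄ = s_{γ,k} w₅`, `w₅ = s_{β,j} w` of the hexagon of `w`. -/
def Labels.vertex (d : Labels) (w : W) : Fin 6 → W :=
  ![w, refl d.α d.i * w, refl d.γ d.k * (refl d.α d.i * w), refl d.γ d.k * w,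
    refl d.γ d.k * (refl d.β d.j * w), refl d.β d.j * w]

/-- The points `P 0, …, P 5` are, in this order, the vertices of a (non-degenerate) convex hexagon
traversed counterclockwise: every other vertex lies strictly to the left of each oriented edge from
`P m` to `P (m + 1)` (indices modulo `6`). -/
def IsConvexHexagon (P : Fin 6 → V) : Prop :=
  ∀ m n : Fin 6, n ≠ m → n ≠ m + 1 → 0 < cross (P (m + 1) - P m) (P n - P m)

/-- The closed region (boundary and interior) of the hexagon of `w`. -/
def Labels.hexagon (d : Labels) (w : W) : Set V :=
  convexHull ℝ (Set.range fun m => center (d.vertex w m))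

end

end AffineA2

/-!
In the barycentric coordinates of the fundamental alcove, scaled by 3, alcove centers have integer
coordinates and the reflections in `W` act by integer formulas. The length of an element is the
number of root hyperplanes that separate its alcove from the fundamental one, so a reflection
raises the length exactly when it moves the alcove center away from the fundamental strip parallel
to its line.

Choose coordinates in which the chamber of `w` is the first quadrant. The hexagon is then given by
six linear inequalities. It contains a point as soon as it contains the image of the point under an
outward reflection, so it contains all `x ≤ w`. Conversely, from every alcove center in the hexagon
other than that of `w`, some outward reflection leads to another point of the hexagon; as the
lengths of these elements are bounded, this process ends at `w`.
-/

namespace AffineA2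

theorem eq_or_eq_add_one_or_eq_add_two (i l : Fin 3) : i = l ∨ i = l + 1 ∨ i = l + 2 := by
  revert i l; decide

theorem sum_eq_rotate {M : Type*} [AddCommMonoid M] (f : Fin 3 → M) (l : Fin 3) :
    ∑ i, f i = f l + f (l + 1) + f (l + 2) := by
  rw [← Equiv.sum_comp (Equiv.addLeft l), Fin.sum_univ_three]
  simp only [Equiv.coe_addLeft, add_zero]

noncomputable section

/-- The gradient of the barycentric coordinate `bary i`, that is, the `i`-th simple root of the
affine root system: the negative of the highest root for `i = 0`, and `αᵢ` otherwise. -/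
def grad (i : Fin 3) : V := if i = 0 then -root 0 else root i

theorem inner_grad_self (i : Fin 3) : inner ℝ (grad i) (grad i) = (2 : ℝ) := by
  have h := inner_root_self i
  rw [innerₗ_apply_apply] at h
  unfold grad
  split_ifs with hi
  · rwa [inner_neg_neg, ← hi]
  · exact h

theorem sum_grad (l : Fin 3) : grad l + grad (l + 1) + grad (l + 2) = 0 := by
  rw [← sum_eq_rotate, Fin.sum_univ_three]
  simp [grad, root_zero]

theorem inner_grad_of_ne {i j : Fin 3} (h : i ≠ j) : inner ℝ (grad i) (grad j) = (-1 : ℝ) := by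
  have h12 : inner ℝ (grad 1) (grad 2) = (-1 : ℝ) := inner_root_one_two
  have h0 : grad 0 = -grad 1 - grad 2 := by simp [grad, root_zero]; abel
  have h1 := inner_grad_self 1
  have h2 := inner_grad_self 2
  fin_cases i <;> fin_cases j <;> first | exact absurd rfl h | skip
  all_goals
    simp only [Fin.zero_eta, Fin.mk_one, Fin.reduceFinMk, h0, inner_sub_left, inner_sub_right,
      inner_neg_left, inner_neg_right, real_inner_comm (grad 1) (grad 2), h1, h2, h12]
    try norm_num

/-- The barycentric coordinates of the plane with respect to the vertices of the fundamental
alcove. The fundamental strips are `0 ≤ bary i v ≤ 1`. -/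
def bary (i : Fin 3) : V →ᵃ[ℝ] ℝ :=
  (innerₗ V (grad i)).toAffineMap + AffineMap.const ℝ V (if i = 0 then 1 else 0)

theorem bary_apply (i : Fin 3) (v : V) :
    bary i v = inner ℝ (grad i) v + if i = 0 then 1 else 0 := rfl

theorem bary_zero_apply (v : V) : bary 0 v = 1 - inner ℝ (root 0) v := by
  simp [bary_apply, grad]; ring

theorem bary_apply_of_ne_zero {i : Fin 3} (hi : i ≠ 0) (v : V) :
    bary i v = inner ℝ (root i) v := by
  simp [bary_apply, grad, hi]

theorem sum_bary (l : Fin 3) (v : V) : bary l v + bary (l + 1) v + bary (l + 2) v = 1 := by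
  rw [← sum_eq_rotate (fun i => bary i v)]
  have hg : ∑ i, grad i = 0 := (sum_eq_rotate grad l).trans (sum_grad l)
  simp only [bary_apply, Finset.sum_add_distrib, ← sum_inner, hg, inner_zero_left,
    Finset.sum_ite_eq', Finset.mem_univ, if_true, zero_add]

theorem bary_sub_smul (j : Fin 3) (v d : V) (t : ℝ) :
    bary j (v - t • d) = bary j v - t * inner ℝ (grad j) d := by
  simp only [bary_apply, inner_sub_right, inner_smul_right]; ring

theorem bary_ext {u v : V} (h : ∀ i, bary i u = bary i v) : u = v := by
  have h1 := h 1
  have h2 := h 2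
  simp only [bary_apply_of_ne_zero (show (1 : Fin 3) ≠ 0 by decide),
    bary_apply_of_ne_zero (show (2 : Fin 3) ≠ 0 by decide), PiLp.inner_apply] at h1 h2
  simp [root, Fin.sum_univ_two] at h1 h2
  ext i
  fin_cases i
  · simpa [h2] using h1
  · simpa using h2

theorem bary_ext_of_add {u v : V} (l : Fin 3) (h1 : bary (l + 1) u = bary (l + 1) v)
    (h2 : bary (l + 2) u = bary (l + 2) v) : u = v := by
  refine bary_ext fun i => ?_
  obtain rfl | rfl | rfl := eq_or_eq_add_one_or_eq_add_two i l
  · linarith [sum_bary i u, sum_bary i v]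
  · exact h1
  · exact h2

-- The Gram matrix of the gradients is `3 I - J`, so a combination of them whose coefficients sum
-- to `0` has its own coefficients, times `3`, as inner products.
theorem exists_bary_eq {t : Fin 3 → ℝ} (ht : ∑ i, t i = 1) : ∃ v : V, ∀ i, bary i v = t i := by
  refine ⟨∑ j, ((t j - if j = 0 then 1 else 0) / 3) • grad j, fun i => ?_⟩
  rw [sum_eq_rotate _ i] at ht ⊢
  have h1 : i ≠ i + 1 := left_ne_add.2 (by decide)
  have h2 : i ≠ i + 2 := left_ne_add.2 (by decide)
  have hδ : (if i = 0 then (1 : ℝ) else 0) + (if i + 1 = 0 then 1 else 0) +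
      (if i + 2 = 0 then 1 else 0) = 1 := by
    rw [← sum_eq_rotate (fun j : Fin 3 => if j = 0 then (1 : ℝ) else 0)]; simp
  rw [bary_apply, inner_add_right, inner_add_right, inner_smul_right, inner_smul_right,
    inner_smul_right, inner_grad_self, inner_grad_of_ne h1, inner_grad_of_ne h2]
  linarith

theorem bary_q (i : Fin 3) : bary i q = 1 / 3 := by
  obtain ⟨h1, h2, h0⟩ := inner_root_q
  fin_cases i
  · exact (bary_zero_apply q).trans h0
  · exact (bary_apply_of_ne_zero (by decide) q).trans h1
  · exact (bary_apply_of_ne_zero (by decide) q).trans h2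

theorem mem_fundStrip {i : Fin 3} {v : V} : v ∈ fundStrip i ↔ 0 ≤ bary i v ∧ bary i v ≤ 1 := by
  unfold fundStrip
  rw [Set.mem_ofPred_eq]
  by_cases hi : i = 0
  · subst hi
    rw [bary_zero_apply, sub_nonneg, sub_le_self_iff, and_comm]
  · rw [bary_apply_of_ne_zero hi]

theorem bary_neg_or_one_lt_of_notMem {v : V} (h : v ∉ ⋃ a, fundStrip a) (i : Fin 3) :
    bary i v < 0 ∨ 1 < bary i v := by
  by_contra! hi
  exact h (Set.mem_iUnion.2 ⟨i, mem_fundStrip.2 hi⟩)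

/-- The index `k` such that `H_{αᵢ,k}` is the line on which the `i`-th barycentric coordinate is
`m`. -/
def level (i : Fin 3) (m : ℤ) : ℤ := if i = 0 then 1 - m else m

theorem level_level (i : Fin 3) (m : ℤ) : level i (level i m) = m := by
  unfold level; split_ifs <;> ring

theorem level_one_sub (i : Fin 3) (m : ℤ) : level i (1 - m) = 1 - level i m := by
  unfold level; split_ifs <;> ring

theorem level_eq_zero_or_one {i : Fin 3} {m : ℤ} :
    level i m = 0 ∨ level i m = 1 ↔ m = 0 ∨ m = 1 := by
  unfold level; split_ifs <;> omega

theorem inner_root_sub_level (i : Fin 3) (m : ℤ) (v : V) :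
    (inner ℝ (root i) v - level i m) • root i = (bary i v - m) • grad i := by
  by_cases hi : i = 0
  · subst hi
    rw [bary_zero_apply, level, grad, if_pos rfl, if_pos rfl, smul_neg, ← neg_smul]
    push_cast
    ring_nf
  · rw [bary_apply_of_ne_zero hi, level, grad, if_neg hi, if_neg hi]

theorem mem_hyperplane_level {i : Fin 3} {m : ℤ} {v : V} :
    v ∈ hyperplane i (level i m) ↔ bary i v = m := by
  rw [hyperplane, Set.mem_ofPred_eq]
  by_cases hi : i = 0
  · subst hi
    rw [bary_zero_apply, level, if_pos rfl]
    push_cast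
    constructor <;> intro h <;> linarith
  · rw [bary_apply_of_ne_zero hi, level, if_neg hi]

theorem norm_root (a : Fin 3) : ‖root a‖ = √2 := by
  rw [norm_eq_sqrt_real_inner, ← innerₗ_apply_apply, inner_root_self]

theorem infDist_hyperplane (a : Fin 3) (k : ℤ) (v : V) :
    Metric.infDist v (hyperplane a k) = |inner ℝ (root a) v - k| / √2 := by
  set c : ℝ := inner ℝ (root a) v - k with hc
  have ha : inner ℝ (root a) (root a) = (2 : ℝ) := inner_root_self a
  have hfoot : v - (c / 2) • root a ∈ hyperplane a k := by
    rw [hyperplane, Set.mem_ofPred_eq, inner_sub_right, inner_smul_right, ha]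
    linarith
  apply le_antisymm
  · refine (Metric.infDist_le_dist_of_mem hfoot).trans_eq ?_
    rw [dist_eq_norm, sub_sub_cancel, norm_smul, norm_root, Real.norm_eq_abs, abs_div,
      abs_two, div_mul_eq_mul_div, div_eq_div_iff two_ne_zero (by positivity), mul_assoc,
      Real.mul_self_sqrt zero_le_two]
  · refine (Metric.le_infDist ⟨_, hfoot⟩).2 fun y hy => ?_
    have hy' : inner ℝ (root a) y = (k : ℝ) := hy
    rw [div_le_iff₀ (by positivity), dist_eq_norm, mul_comm, ← norm_root a, hc, ← hy',
      ← inner_sub_right]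
    exact abs_real_inner_le_norm _ _

theorem infDist_hyperplane_level (i : Fin 3) (m : ℤ) (v : V) :
    Metric.infDist v (hyperplane i (level i m)) = |bary i v - m| / √2 := by
  have h := congrArg norm (inner_root_sub_level i m v)
  have hg : ‖grad i‖ = √2 := by rw [norm_eq_sqrt_real_inner, inner_grad_self]
  rw [norm_smul, norm_smul, norm_root, hg, Real.norm_eq_abs, Real.norm_eq_abs] at h
  rw [infDist_hyperplane, mul_right_cancel₀ (by positivity) h]

theorem sqrt_three_mul_cross (l : Fin 3) (u v : V) : √3 * cross u v =
    inner ℝ (grad (l + 1)) u * inner ℝ (grad (l + 2)) v -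
      inner ℝ (grad (l + 2)) u * inner ℝ (grad (l + 1)) v := by
  have h0 : ∀ v : V, inner ℝ (grad l) v + inner ℝ (grad (l + 1)) v + inner ℝ (grad (l + 2)) v =
      (0 : ℝ) := fun v => by
    rw [← inner_add_left, ← inner_add_left, sum_grad, inner_zero_left]
  have h6 : √6 = √2 * √3 := by rw [← Real.sqrt_mul zero_le_two]; norm_num
  have h2 : √2 * √2 = 2 := Real.mul_self_sqrt zero_le_two
  have h12 : √3 * cross u v = inner ℝ (grad 1) u * inner ℝ (grad 2) v -
      inner ℝ (grad 2) u * inner ℝ (grad 1) v := by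
    simp [grad, root, PiLp.inner_apply, Fin.sum_univ_two, cross, h6]
    linear_combination (-(√3 / 2) * (u 0 * v 1 - u 1 * v 0)) * h2
  have hu := h0 u
  have hv := h0 v
  fin_cases l
  · exact h12
  · simp only [Fin.mk_one, Fin.isValue, Fin.reduceAdd] at *
    linear_combination h12 + inner ℝ (grad 2) v * hu - inner ℝ (grad 2) u * hv
  · simp only [Fin.reduceFinMk, Fin.isValue, Fin.reduceAdd] at *
    linear_combination h12 - inner ℝ (grad 1) v * hu + inner ℝ (grad 1) u * hv

/-- The reflection in the line on which the `i`-th barycentric coordinate is `m`. -/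
def baryRefl (i : Fin 3) (m : ℤ) : W := refl i (level i m)

theorem refl_eq_baryRefl (i : Fin 3) (k : ℤ) : refl i k = baryRefl i (level i k) := by
  rw [baryRefl, level_level]

theorem simple_eq_baryRefl (i : Fin 3) : simple i = baryRefl i 0 := by
  fin_cases i <;> rfl

theorem baryRefl_apply (i : Fin 3) (m : ℤ) (v : V) :
    (baryRefl i m : V ≃ᵃ[ℝ] V) v = v - (bary i v - m) • grad i := by
  rw [← inner_root_sub_level, ← affRefl_apply]
  rfl

theorem bary_baryRefl_self (i : Fin 3) (m : ℤ) (v : V) :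
    bary i ((baryRefl i m : V ≃ᵃ[ℝ] V) v) = 2 * m - bary i v := by
  rw [baryRefl_apply, bary_sub_smul, inner_grad_self]
  ring

theorem bary_baryRefl_of_ne {i j : Fin 3} (h : j ≠ i) (m : ℤ) (v : V) :
    bary j ((baryRefl i m : V ≃ᵃ[ℝ] V) v) = bary j v + bary i v - m := by
  rw [baryRefl_apply, bary_sub_smul, inner_grad_of_ne h]
  ring

theorem W_ext {u w : W} (h : ∀ i v, bary i ((u : V ≃ᵃ[ℝ] V) v) = bary i ((w : V ≃ᵃ[ℝ] V) v)) :
    u = w :=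
  Subtype.ext <| AffineEquiv.ext fun v => bary_ext fun i => h i v

theorem coe_mul_apply (u w : W) (v : V) :
    ((u * w : W) : V ≃ᵃ[ℝ] V) v = (u : V ≃ᵃ[ℝ] V) ((w : V ≃ᵃ[ℝ] V) v) := rfl

theorem baryRefl_conj_self (i : Fin 3) (k m : ℤ) :
    baryRefl i k * baryRefl i m * baryRefl i k = baryRefl i (2 * k - m) := by
  refine W_ext fun j v => ?_
  simp only [coe_mul_apply]
  obtain rfl | h := eq_or_ne j i
  · simp only [bary_baryRefl_self]
    push_cast; ring
  · simp only [bary_baryRefl_self, bary_baryRefl_of_ne h]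
    push_cast; ring

theorem baryRefl_mul_self (i : Fin 3) (m : ℤ) : baryRefl i m * baryRefl i m = 1 := by
  refine W_ext fun j v => ?_
  rw [coe_mul_apply]
  obtain rfl | h := eq_or_ne j i
  · rw [bary_baryRefl_self, bary_baryRefl_self, sub_sub_cancel]
    rfl
  · rw [bary_baryRefl_of_ne h, bary_baryRefl_of_ne h, bary_baryRefl_self]
    change _ = bary j v
    ring

theorem baryRefl_inv (i : Fin 3) (m : ℤ) : (baryRefl i m)⁻¹ = baryRefl i m :=
  inv_eq_of_mul_eq_one_right (baryRefl_mul_self i m)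

theorem baryRefl_conj_of_ne {i j l : Fin 3} (hij : i ≠ j) (hil : i ≠ l) (hjl : j ≠ l) (k m : ℤ) :
    baryRefl i k * baryRefl j m * baryRefl i k = baryRefl l (1 - k - m) := by
  have hcases : ∀ n, n = i ∨ n = j ∨ n = l := by revert i j l; decide
  refine W_ext fun n v => ?_
  have hsum : bary i v + bary j v + bary l v = 1 := by
    obtain ⟨rfl, rfl⟩ | ⟨rfl, rfl⟩ : (j = i + 1 ∧ l = i + 2) ∨ (j = i + 2 ∧ l = i + 1) := by
      clear hcases; revert i j l; decide
    · exact sum_bary i v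
    · linarith [sum_bary i v]
  simp only [coe_mul_apply]
  obtain rfl | rfl | rfl := hcases n <;>
    simp only [bary_baryRefl_self, bary_baryRefl_of_ne hij, bary_baryRefl_of_ne hil,
      bary_baryRefl_of_ne hjl, bary_baryRefl_of_ne hij.symm, bary_baryRefl_of_ne hil.symm,
      bary_baryRefl_of_ne hjl.symm] <;> push_cast <;> linarith

theorem exists_baryRefl_conj (i j : Fin 3) (k m : ℤ) :
    ∃ l n, baryRefl i k * baryRefl j m * baryRefl i k = baryRefl l n := by
  obtain rfl | h := eq_or_ne i j
  · exact ⟨_, _, baryRefl_conj_self i k m⟩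
  · obtain ⟨l, h1, h2⟩ : ∃ l, i ≠ l ∧ j ≠ l := by revert i j; decide
    exact ⟨_, _, baryRefl_conj_of_ne h h1 h2 k m⟩

theorem W_induction {p : W → Prop} (one : p 1) (mul : ∀ i m w, p w → p (baryRefl i m * w))
    (w : W) : p w := by
  have refl_mul : ∀ i k w, p w → p (refl i k * w) := fun i k w hw => by
    rw [refl_eq_baryRefl]; exact mul _ _ _ hw
  obtain ⟨w, hw⟩ := w
  induction hw using Subgroup.closure_induction_left with
  | one => exact one
  | mul_left x hx y hy ih =>
    obtain ⟨⟨i, k⟩, rfl⟩ := hx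
    exact refl_mul i k _ ih
  | inv_mul_cancel x hx y hy ih =>
    obtain ⟨⟨i, k⟩, rfl⟩ := hx
    have h := refl_mul i k _ ih
    rwa [refl_eq_baryRefl, ← baryRefl_inv, ← refl_eq_baryRefl] at h

theorem isReflection_iff {r : W} : IsReflection r ↔ ∃ i m, r = baryRefl i m := by
  constructor
  · rintro ⟨u, i, rfl⟩
    rw [simple_eq_baryRefl]
    generalize (0 : ℤ) = m
    induction u using W_induction with
    | one => exact ⟨i, m, by rw [one_mul, inv_one, mul_one]⟩
    | mul j k w ih =>
      obtain ⟨l, n, h⟩ := ih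
      obtain ⟨l', n', h'⟩ := exists_baryRefl_conj j l k n
      refine ⟨l', n', ?_⟩
      rw [← h', ← h, mul_inv_rev, baryRefl_inv]
      simp only [mul_assoc]
  · rintro ⟨l, m, rfl⟩
    refine ⟨baryRefl (l + 1) (1 - m), l + 2, ?_⟩
    rw [simple_eq_baryRefl, baryRefl_inv, baryRefl_conj_of_ne (l := l), sub_sub_cancel, sub_zero]
    all_goals revert l; decide

/-- The coordinates of the plane in which `W` acts by permutations of the coordinates followed by
translations by integers. They are the coordinates in which the roots are the differences of
coordinate functions, with the origin moved so that `eps i q = -i / 3`. -/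
def eps (i : Fin 3) (v : V) : ℝ := (bary (i + 1) v - bary i v - (i : ℕ)) / 3

theorem eps_q (i : Fin 3) : eps i q = -(i : ℕ) / 3 := by
  rw [eps, bary_q, bary_q, sub_self, zero_sub]

theorem eps_ext {u v : V} (h : ∀ i, eps i u = eps i v) : u = v := by
  refine bary_ext fun i => ?_
  have h0 := h i
  have h2 := h (i + 2)
  have hi : i + 2 + 1 = i := by rw [add_assoc]; exact add_zero i
  rw [eps, eps] at h0 h2
  rw [hi] at h2
  linarith [sum_bary i u, sum_bary i v]

theorem exists_eps_baryRefl (i : Fin 3) (m : ℤ) : ∃ (π : Equiv.Perm (Fin 3)) (n : Fin 3 → ℤ),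
    ∀ j v, eps j ((baryRefl i m : V ≃ᵃ[ℝ] V) v) = eps (π j) v + n j := by
  refine ⟨Equiv.swap i (i + 2), Pi.single (i + 2) (m - if i = 0 then 1 else 0) -
    Pi.single i (m - if i = 0 then 1 else 0), fun j v => ?_⟩
  have hsum := sum_bary i v
  have hself := bary_baryRefl_self i m v
  have h1 : bary (i + 1) ((baryRefl i m : V ≃ᵃ[ℝ] V) v) = _ :=
    bary_baryRefl_of_ne (add_ne_left.2 (by decide)) m v
  have h2 : bary (i + 2) ((baryRefl i m : V ≃ᵃ[ℝ] V) v) = _ :=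
    bary_baryRefl_of_ne (add_ne_left.2 (by decide)) m v
  unfold eps
  fin_cases i <;> fin_cases j <;> simp [Equiv.swap_apply_of_ne_of_ne] at * <;> linarith

theorem exists_eps_eq (w : W) : ∃ (π : Equiv.Perm (Fin 3)) (n : Fin 3 → ℤ),
    ∀ j v, eps j ((w : V ≃ᵃ[ℝ] V) v) = eps (π j) v + n j := by
  induction w using W_induction with
  | one => exact ⟨1, 0, fun j v => by simp⟩
  | mul i m w ih =>
    obtain ⟨π, n, h⟩ := ih
    obtain ⟨π', n', h'⟩ := exists_eps_baryRefl i m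
    refine ⟨π * π', fun j => n (π' j) + n' j, fun j v => ?_⟩
    rw [coe_mul_apply, h', h, Equiv.Perm.mul_apply]
    push_cast; ring

-- An element that fixes `q` does not permute the coordinates `eps i`, because their values at `q`
-- are pairwise incongruent modulo `1`.
theorem center_injective : Function.Injective center := by
  intro u w huw
  rw [← inv_mul_eq_one]
  have hq : ((u⁻¹ * w : W) : V ≃ᵃ[ℝ] V) q = q := by
    change ((u : V ≃ᵃ[ℝ] V)⁻¹) (center w) = q
    rw [← huw]
    exact (u : V ≃ᵃ[ℝ] V).symm_apply_apply q
  obtain ⟨π, n, h⟩ := exists_eps_eq (u⁻¹ * w)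
  have hmod : ∀ i, π i = i ∧ n i = 0 := fun i => by
    have hi := h i q
    rw [hq, eps_q, eps_q] at hi
    have hi' : ((π i : ℕ) : ℤ) - (i : ℕ) = 3 * n i := by
      rify; linarith
    omega
  exact Subtype.ext <| AffineEquiv.ext fun v => eps_ext fun i => by
    rw [h, (hmod i).1, (hmod i).2, Int.cast_zero, add_zero]
    rfl

theorem center_mul (u w : W) : center (u * w) = (u : V ≃ᵃ[ℝ] V) (center w) := rfl

theorem exists_coord (w : W) : ∃ x : Fin 3 → ℤ, (∀ i, (x i : ℝ) = 3 * bary i (center w)) ∧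
    (∀ i j, x i % 3 = x j % 3) ∧ ∀ i, x i % 3 ≠ 0 := by
  induction w using W_induction with
  | one =>
    refine ⟨1, fun i => ?_, fun _ _ => rfl, fun _ => one_ne_zero⟩
    rw [show center 1 = q from rfl, bary_q, Pi.one_apply]
    norm_num
  | mul i m w ih =>
    obtain ⟨x, hx, hmod, hne⟩ := ih
    refine ⟨fun j => if j = i then 6 * m - x i else x j + x i - 3 * m, fun j => ?_, fun j k => ?_,
      fun j => ?_⟩
    · rw [center_mul]
      dsimp only
      split_ifs with h
      · rw [h, bary_baryRefl_self]
        push_cast; rw [hx]; ring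
      · rw [bary_baryRefl_of_ne h]
        push_cast; rw [hx, hx]; ring
    · have := hmod i j
      have := hmod i k
      have := hne i
      dsimp only
      split_ifs <;> omega
    · have := hmod i j
      have := hne i
      dsimp only
      split_ifs <;> omega

/-- The barycentric coordinates of the alcove center of `w`, scaled by `3` to be integers. -/
def coord (w : W) : Fin 3 → ℤ := (exists_coord w).choose

theorem coord_cast (w : W) (i : Fin 3) : (coord w i : ℝ) = 3 * bary i (center w) :=
  (exists_coord w).choose_spec.1 i

theorem coord_emod (w : W) (i j : Fin 3) : coord w i % 3 = coord w j % 3 :=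
  (exists_coord w).choose_spec.2.1 i j

theorem coord_emod_ne (w : W) (i : Fin 3) : coord w i % 3 ≠ 0 :=
  (exists_coord w).choose_spec.2.2 i

theorem coord_add (w : W) (l : Fin 3) : coord w l + coord w (l + 1) + coord w (l + 2) = 3 := by
  rify
  simp only [coord_cast]
  linarith [sum_bary l (center w)]

theorem coord_baryRefl_self (i : Fin 3) (m : ℤ) (w : W) :
    coord (baryRefl i m * w) i = 6 * m - coord w i := by
  rify
  rw [coord_cast, coord_cast, center_mul, bary_baryRefl_self]
  ring

theorem coord_baryRefl_of_ne {i j : Fin 3} (h : j ≠ i) (m : ℤ) (w : W) :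
    coord (baryRefl i m * w) j = coord w j + coord w i - 3 * m := by
  rify
  rw [coord_cast, coord_cast, coord_cast, center_mul, bary_baryRefl_of_ne h]
  ring

theorem eq_of_coord {u w : W} (l : Fin 3) (h1 : coord u (l + 1) = coord w (l + 1))
    (h2 : coord u (l + 2) = coord w (l + 2)) : u = w := by
  rify [coord_cast] at h1 h2
  exact center_injective (bary_ext_of_add l (by linarith) (by linarith))

theorem coord_one (i : Fin 3) : coord 1 i = 1 := by
  have h : (coord 1 i : ℝ) = 3 * bary i q := coord_cast 1 i
  rify
  rw [h, bary_q]
  norm_num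

/-- The index of the strip `k ≤ bary i v ≤ k + 1` that contains the alcove center of `w`. -/
def strip (w : W) (i : Fin 3) : ℤ := coord w i / 3

theorem strip_add (w : W) (l : Fin 3) :
    strip w l + strip w (l + 1) + strip w (l + 2) = 0 ∨
      strip w l + strip w (l + 1) + strip w (l + 2) = -1 := by
  have := coord_add w l
  have := coord_emod w l (l + 1)
  have := coord_emod w l (l + 2)
  have := coord_emod_ne w l
  unfold strip
  omega

theorem strip_baryRefl_self (i : Fin 3) (m : ℤ) (w : W) :
    strip (baryRefl i m * w) i = 2 * m - 1 - strip w i := by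
  have := coord_emod_ne w i
  rw [strip, strip, coord_baryRefl_self]
  omega

theorem strip_baryRefl_add_one (i : Fin 3) (m : ℤ) (w : W) :
    strip (baryRefl i m * w) (i + 1) = -(strip w (i + 2) + m) := by
  have := coord_add w i
  have := coord_emod_ne w (i + 2)
  rw [strip, strip, coord_baryRefl_of_ne (add_ne_left.2 (by decide))]
  omega

theorem strip_baryRefl_add_two (i : Fin 3) (m : ℤ) (w : W) :
    strip (baryRefl i m * w) (i + 2) = -(strip w (i + 1) + m) := by
  have := coord_add w i
  have := coord_emod_ne w (i + 1)
  rw [strip, strip, coord_baryRefl_of_ne (add_ne_left.2 (by decide))]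
  omega

/-- The number of root hyperplanes that separate the alcove of `w` from the fundamental alcove; it
turns out to be the length of `w`. -/
def sep (w : W) : ℕ := ∑ i, (strip w i).natAbs

theorem sep_one : sep 1 = 0 := by
  simp [sep, strip, coord_one]

/-- The reflection in the line `t = n` moves the point with coordinate `t` away from the strip
`a - 3 ≤ t ≤ a`. -/
def Outward (a t n : ℤ) : Prop := (t < n ∧ a ≤ n) ∨ (n < t ∧ n ≤ a - 3)

theorem sep_lt_sep_baryRefl {w : W} {i : Fin 3} {m : ℤ} (h : Outward 3 (coord w i) (3 * m)) :
    sep w < sep (baryRefl i m * w) := by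
  have hsum := strip_add w i
  have hm : (strip w i < m ∧ 1 ≤ m) ∨ (m ≤ strip w i ∧ m ≤ 0) := by
    unfold strip; unfold Outward at h; omega
  rw [sep, sep, sum_eq_rotate _ i, sum_eq_rotate _ i, strip_baryRefl_self, strip_baryRefl_add_one,
    strip_baryRefl_add_two]
  omega

theorem sep_simple_le (i : Fin 3) (w : W) : sep (simple i * w) ≤ sep w + 1 := by
  rw [simple_eq_baryRefl, sep, sep, sum_eq_rotate _ i, sum_eq_rotate _ i, strip_baryRefl_self,
    strip_baryRefl_add_one, strip_baryRefl_add_two]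
  omega

theorem sep_simple_of_neg {i : Fin 3} {w : W} (h : coord w i < 0) :
    sep (simple i * w) + 1 = sep w := by
  have hi : strip w i < 0 := by unfold strip; omega
  rw [simple_eq_baryRefl, sep, sep, sum_eq_rotate _ i, sum_eq_rotate _ i, strip_baryRefl_self,
    strip_baryRefl_add_one, strip_baryRefl_add_two]
  omega

theorem eq_one_or_exists_coord_neg (w : W) : w = 1 ∨ ∃ i, coord w i < 0 := by
  refine or_iff_not_imp_right.2 fun h => ?_
  have hpos : ∀ i, 0 < coord w i := fun i => by
    have := coord_emod_ne w i
    have : ¬ coord w i < 0 := fun hi => h ⟨i, hi⟩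
    omega
  have := coord_add w 0
  have := hpos 0
  have := hpos (0 + 1)
  have := hpos (0 + 2)
  exact eq_of_coord 0 (by rw [coord_one]; omega) (by rw [coord_one]; omega)

theorem exists_word (w : W) : ∃ l : List (Fin 3), l.length = sep w ∧ (l.map simple).prod = w := by
  induction hn : sep w generalizing w with
  | zero =>
    obtain rfl | ⟨i, hi⟩ := eq_one_or_exists_coord_neg w
    · exact ⟨[], rfl, rfl⟩
    · have := sep_simple_of_neg hi
      omega
  | succ n ih =>
    obtain rfl | ⟨i, hi⟩ := eq_one_or_exists_coord_neg w
    · rw [sep_one] at hn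
      omega
    · have := sep_simple_of_neg hi
      obtain ⟨l, hl, hp⟩ := ih (simple i * w) (by omega)
      refine ⟨i :: l, congrArg Nat.succ hl, ?_⟩
      rw [List.map_cons, List.prod_cons, hp, ← mul_assoc, simple_eq_baryRefl, baryRefl_mul_self,
        one_mul]

theorem sep_prod_le (l : List (Fin 3)) : sep (l.map simple).prod ≤ l.length := by
  induction l with
  | nil => exact sep_one.le
  | cons i l ih =>
    rw [List.map_cons, List.prod_cons, List.length_cons]
    exact (sep_simple_le i _).trans (Nat.succ_le_succ ih)

theorem length_eq_sep (w : W) : length w = sep w := by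
  apply le_antisymm
  · exact Nat.sInf_le (exists_word w)
  · refine le_csInf ⟨_, exists_word w⟩ ?_
    rintro n ⟨l, rfl, rfl⟩
    exact sep_prod_le l

theorem length_lt_length_baryRefl_iff {w : W} {i : Fin 3} {m : ℤ} :
    length w < length (baryRefl i m * w) ↔ Outward 3 (coord w i) (3 * m) := by
  rw [length_eq_sep, length_eq_sep]
  refine ⟨fun h => ?_, sep_lt_sep_baryRefl⟩
  by_contra hw
  have hrefl : Outward 3 (coord (baryRefl i m * w) i) (3 * m) := by
    have := coord_emod_ne w i
    rw [coord_baryRefl_self]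
    unfold Outward at *
    omega
  have := sep_lt_sep_baryRefl hrefl
  rw [← mul_assoc, baryRefl_mul_self, one_mul] at this
  omega

theorem bruhat_step_iff {x y : W} :
    (∃ r : W, IsReflection r ∧ y = r * x ∧ length x < length y) ↔
      ∃ i m, y = baryRefl i m * x ∧ Outward 3 (coord x i) (3 * m) := by
  constructor
  · rintro ⟨r, hr, rfl, h⟩
    obtain ⟨i, m, rfl⟩ := isReflection_iff.1 hr
    exact ⟨i, m, rfl, length_lt_length_baryRefl_iff.1 h⟩
  · rintro ⟨i, m, rfl, h⟩
    exact ⟨_, isReflection_iff.2 ⟨i, m, rfl⟩, rfl, length_lt_length_baryRefl_iff.2 h⟩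

theorem bruhatLE_iff_of_steps {w : W} {S : W → Prop} (hw : S w)
    (down : ∀ x i m, Outward 3 (coord x i) (3 * m) → S (baryRefl i m * x) → S x)
    (up : ∀ x, S x → x ≠ w → ∃ i m, Outward 3 (coord x i) (3 * m) ∧ S (baryRefl i m * x))
    {N : ℕ} (bdd : ∀ x, S x → sep x ≤ N) (x : W) : BruhatLE x w ↔ S x := by
  constructor
  · intro h
    induction h using Relation.ReflTransGen.head_induction_on with
    | refl => exact hw
    | head h _ ih =>
      obtain ⟨i, m, rfl, ho⟩ := bruhat_step_iff.1 h
      exact down _ i m ho ih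
  · intro hx
    induction hn : N - sep x using Nat.strong_induction_on generalizing x with
    | h n ih =>
      obtain rfl | hxw := eq_or_ne x w
      · exact .refl
      · obtain ⟨i, m, ho, hS⟩ := up x hx hxw
        have hlt := sep_lt_sep_baryRefl ho
        have hle := bdd _ hS
        exact .head (bruhat_step_iff.2 ⟨i, m, rfl, ho⟩) (ih _ (by omega) _ hS rfl)

/-- The oriented area of the parallelogram spanned by two vectors, in coordinates. -/
def det {R : Type*} [CommRing R] (a b : R × R) : R := a.1 * b.2 - a.2 * b.1

/-- The six chambers: the walls of the chamber `S` are carried by the lines on which the barycentric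
coordinates `S.γ + 1` and `S.γ + 2` are equal to `S.e`. If `S.e = 0`, then both coordinates are
negative in the chamber; if `S.e = 1`, then both are greater than `1`. -/
structure Sector where
  γ : Fin 3
  e : ℤ
  e_mem : e = 0 ∨ e = 1

namespace Sector

variable (S : Sector)

/-- The sign of the barycentric coordinates `S.γ + 1` and `S.γ + 2` in the chamber `S`. -/
def sign : ℤ := 2 * S.e - 1

theorem sign_mul_sign : S.sign * S.sign = 1 := by
  unfold sign
  rcases S.e_mem with h | h <;> rw [h] <;> rfl

theorem cast_sign_mul_sign : (S.sign * S.sign : ℝ) = 1 := mod_cast S.sign_mul_sign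

theorem cast_sign_ne_zero : (S.sign : ℝ) ≠ 0 := left_ne_zero_of_mul_eq_one S.cast_sign_mul_sign

/-- The affine map underlying `Sector.chart`. -/
def chartMap : V →ᵃ[ℝ] ℝ × ℝ :=
  ((S.sign : ℝ) • (bary (S.γ + 1) - AffineMap.const ℝ V (S.e : ℝ))).prod
    ((S.sign : ℝ) • (bary (S.γ + 2) - AffineMap.const ℝ V (S.e : ℝ)))

theorem chartMap_apply (v : V) : S.chartMap v =
    (S.sign * (bary (S.γ + 1) v - S.e), S.sign * (bary (S.γ + 2) v - S.e)) := rfl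

theorem chartMap_bijective : Function.Bijective S.chartMap := by
  constructor
  · intro u v h
    rw [chartMap_apply, chartMap_apply, Prod.mk_inj] at h
    exact bary_ext_of_add S.γ
      (sub_left_injective (mul_left_cancel₀ S.cast_sign_ne_zero h.1))
      (sub_left_injective (mul_left_cancel₀ S.cast_sign_ne_zero h.2))
  · rintro ⟨x, y⟩
    have h1 : S.γ + 1 ≠ S.γ := add_ne_left.2 (by decide)
    have h2 : S.γ + 2 ≠ S.γ := add_ne_left.2 (by decide)
    have h3 : S.γ + 2 ≠ S.γ + 1 := (add_right_injective S.γ).ne (by decide)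
    obtain ⟨v, hv⟩ := exists_bary_eq (t := fun i => if i = S.γ + 1 then S.e + S.sign * x else
      if i = S.γ + 2 then S.e + S.sign * y else
        1 - (S.e + S.sign * x) - (S.e + S.sign * y)) (by
      rw [sum_eq_rotate _ S.γ]
      simp only [if_neg h1.symm, if_neg h2.symm, if_neg h3, if_true]
      ring)
    refine ⟨v, ?_⟩
    rw [chartMap_apply, hv, hv, if_pos rfl, if_neg h3, if_pos rfl]
    simp only [add_sub_cancel_left, ← mul_assoc, S.cast_sign_mul_sign, one_mul]

/-- The affine coordinates of the plane in which the chamber `S` is the open first quadrant, the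
first coordinate being proportional to the distance from the wall in direction `S.γ + 1`. -/
def chart : V ≃ᵃ[ℝ] ℝ × ℝ := AffineEquiv.ofBijective S.chartMap_bijective

theorem chart_fst (v : V) : (S.chart v).1 = S.sign * (bary (S.γ + 1) v - S.e) := rfl

theorem chart_snd (v : V) : (S.chart v).2 = S.sign * (bary (S.γ + 2) v - S.e) := rfl

theorem bary_add_one (v : V) : bary (S.γ + 1) v = S.e + S.sign * (S.chart v).1 := by
  rw [chart_fst, ← mul_assoc, S.cast_sign_mul_sign]
  ring

theorem bary_add_two (v : V) : bary (S.γ + 2) v = S.e + S.sign * (S.chart v).2 := by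
  rw [chart_snd, ← mul_assoc, S.cast_sign_mul_sign]
  ring

theorem bary_self (v : V) :
    bary S.γ v = 1 - 2 * S.e - S.sign * ((S.chart v).1 + (S.chart v).2) := by
  linear_combination sum_bary S.γ v - S.bary_add_one v - S.bary_add_two v

theorem chart_fst_eq_zero_iff {v : V} : (S.chart v).1 = 0 ↔ bary (S.γ + 1) v = S.e := by
  rw [chart_fst, mul_eq_zero, or_iff_right S.cast_sign_ne_zero, sub_eq_zero]

theorem chart_snd_eq_zero_iff {v : V} : (S.chart v).2 = 0 ↔ bary (S.γ + 2) v = S.e := by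
  rw [chart_snd, mul_eq_zero, or_iff_right S.cast_sign_ne_zero, sub_eq_zero]

/-- The chamber `S`. -/
def cone : Set V := S.chart ⁻¹' (Set.Ioi 0 ×ˢ Set.Ioi 0)

theorem mem_cone {v : V} : v ∈ S.cone ↔ 0 < (S.chart v).1 ∧ 0 < (S.chart v).2 := Iff.rfl

theorem convex_cone : Convex ℝ S.cone :=
  ((convex_Ioi 0).prod (convex_Ioi 0)).affine_preimage S.chart.toAffineMap

theorem isOpen_cone : IsOpen S.cone :=
  (isOpen_Ioi.prod isOpen_Ioi).preimage S.chart.toContinuousAffineEquiv.continuous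

theorem mem_closure_cone {v : V} : v ∈ closure S.cone ↔ 0 ≤ (S.chart v).1 ∧ 0 ≤ (S.chart v).2 := by
  have h := S.chart.toContinuousAffineEquiv.toHomeomorph.preimage_closure (Set.Ioi 0 ×ˢ Set.Ioi 0)
  rw [closure_prod_eq, closure_Ioi] at h
  exact (Set.ext_iff.1 h v).symm

theorem mem_frontier_cone {v : V} : v ∈ frontier S.cone ↔
    (0 ≤ (S.chart v).1 ∧ (S.chart v).2 = 0) ∨ ((S.chart v).1 = 0 ∧ 0 ≤ (S.chart v).2) := by
  have h := S.chart.toContinuousAffineEquiv.toHomeomorph.preimage_frontier (Set.Ioi 0 ×ˢ Set.Ioi 0)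
  rw [frontier_prod_eq, closure_Ioi, frontier_Ioi] at h
  exact (Set.ext_iff.1 h v).symm

theorem exists_mem_cone {v : V} (hv : v ∉ ⋃ a, fundStrip a) : ∃ S : Sector, v ∈ S.cone := by
  have neg : ∀ l, bary (l + 1) v < 0 → bary (l + 2) v < 0 → ∃ S : Sector, v ∈ S.cone :=
    fun l h1 h2 => ⟨⟨l, 0, .inl rfl⟩, (mem_cone _).2 <| by
      rw [chart_fst, chart_snd]; simp [sign, h1, h2]⟩
  have pos : ∀ l, 1 < bary (l + 1) v → 1 < bary (l + 2) v → ∃ S : Sector, v ∈ S.cone :=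
    fun l h1 h2 => ⟨⟨l, 1, .inr rfl⟩, (mem_cone _).2 <| by
      rw [chart_fst, chart_snd]; simp [sign, h1, h2]⟩
  have := sum_bary 0 v
  rcases bary_neg_or_one_lt_of_notMem hv 0 with h0 | h0 <;>
    rcases bary_neg_or_one_lt_of_notMem hv (0 + 1) with h1 | h1 <;>
    rcases bary_neg_or_one_lt_of_notMem hv (0 + 2) with h2 | h2
  · exact neg 0 h1 h2
  · exact neg 2 h0 h1
  · exact neg 1 h2 h0
  · exact pos 0 h1 h2
  · exact neg 0 h1 h2
  · exact pos 1 h2 h0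
  · exact pos 2 h0 h1
  · exact pos 0 h1 h2

theorem cone_subset : S.cone ⊆ (⋃ a, fundStrip a)ᶜ := by
  rintro v ⟨h1 : 0 < (S.chart v).1, h2 : 0 < (S.chart v).2⟩ hv
  obtain ⟨i, hi⟩ := Set.mem_iUnion.1 hv
  rw [mem_fundStrip] at hi
  have b0 := S.bary_self v
  have b1 := S.bary_add_one v
  have b2 := S.bary_add_two v
  unfold sign at b0 b1 b2
  obtain rfl | rfl | rfl := eq_or_eq_add_one_or_eq_add_two i S.γ <;>
    rcases S.e_mem with he | he <;> rw [he] at b0 b1 b2 <;> push_cast at b0 b1 b2 <;> linarith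

theorem mem_cone_of_mem_closure {v : V} (hv : v ∈ closure S.cone) (hv' : v ∉ ⋃ a, fundStrip a) :
    v ∈ S.cone := by
  have he : (S.e : ℝ) = 0 ∨ (S.e : ℝ) = 1 := by exact_mod_cast S.e_mem
  rw [mem_closure_cone] at hv
  refine ⟨hv.1.lt_of_ne' fun h => ?_, hv.2.lt_of_ne' fun h => ?_⟩
  · have hi := bary_neg_or_one_lt_of_notMem hv' (S.γ + 1)
    rw [S.chart_fst_eq_zero_iff.1 h] at hi
    rcases he with h | h <;> rw [h] at hi <;> norm_num at hi
  · have hi := bary_neg_or_one_lt_of_notMem hv' (S.γ + 2)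
    rw [S.chart_snd_eq_zero_iff.1 h] at hi
    rcases he with h | h <;> rw [h] at hi <;> norm_num at hi

theorem chamber_eq_cone {w : W} (hw : center w ∈ S.cone) : chamber w = S.cone := by
  apply subset_antisymm
  · refine isPreconnected_connectedComponentIn.subset_of_closure_inter_subset S.isOpen_cone
      ⟨_, mem_connectedComponentIn (S.cone_subset hw), hw⟩ ?_
    exact fun v hv => S.mem_cone_of_mem_closure hv.1 (connectedComponentIn_subset _ _ hv.2)
  · exact S.convex_cone.isPreconnected.subset_connectedComponentIn hw S.cone_subset

/-- The labels of the elements whose alcove center lies in the chamber `S`. -/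
def labels : Labels :=
  ⟨S.γ + 1, level (S.γ + 1) S.e, S.γ + 2, level (S.γ + 2) S.e, S.γ, level S.γ (1 - S.e)⟩

theorem isWall_of_chart_ray {C : Set V} {a : Fin 3} {k : ℤ} {d : ℝ × ℝ} (hd : d ≠ 0)
    (h : ∀ v, (∃ t : ℝ, 0 ≤ t ∧ S.chart v = t • d) → v ∈ frontier C ∩ hyperplane a k) :
    IsWall C a k := by
  refine ⟨S.chart.symm 0, S.chart.linear.symm d, by simpa using hd, fun t ht => h _ ⟨t, ht, ?_⟩⟩
  rw [add_comm, ← vadd_eq_add, AffineEquiv.map_vadd, AffineEquiv.apply_symm_apply, map_smul,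
    LinearEquiv.apply_symm_apply, vadd_eq_add, add_zero]

theorem isWall_add_one : IsWall S.cone (S.γ + 1) (level (S.γ + 1) S.e) := by
  refine S.isWall_of_chart_ray (d := (0, 1)) (by simp) ?_
  rintro v ⟨t, ht, hv⟩
  rw [Set.mem_inter_iff, mem_frontier_cone, mem_hyperplane_level, ← chart_fst_eq_zero_iff, hv]
  simp [ht]

theorem isWall_add_two : IsWall S.cone (S.γ + 2) (level (S.γ + 2) S.e) := by
  refine S.isWall_of_chart_ray (d := (1, 0)) (by simp) ?_
  rintro v ⟨t, ht, hv⟩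
  rw [Set.mem_inter_iff, mem_frontier_cone, mem_hyperplane_level, ← chart_snd_eq_zero_iff, hv]
  simp [ht]

theorem eq_e_of_mem_closure_cone {v : V} (hv : v ∈ closure S.cone) {i : Fin 3} (hi : i ≠ S.γ)
    {m : ℤ} (hm : m = 0 ∨ m = 1) (h : bary i v = m) : m = S.e := by
  rw [mem_closure_cone] at hv
  have b1 := S.bary_add_one v
  have b2 := S.bary_add_two v
  unfold sign at b1 b2
  have hsign : S.e = 0 ∧ bary i v ≤ 0 ∨ S.e = 1 ∧ 1 ≤ bary i v := by
    refine S.e_mem.imp (fun he => ⟨he, ?_⟩) (fun he => ⟨he, ?_⟩) <;>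
      rw [he] at b1 b2 <;> push_cast at b1 b2 <;>
      obtain rfl | rfl | rfl := eq_or_eq_add_one_or_eq_add_two i S.γ <;>
      first | exact absurd rfl hi | linarith
  rw [h] at hsign
  norm_cast at hsign
  omega

theorem chart_eq_zero_of_mem_closure_cone {v : V} (hv : v ∈ closure S.cone) {m : ℤ}
    (hm : m = 0 ∨ m = 1) (h : bary S.γ v = m) : S.chart v = 0 := by
  obtain ⟨h1, h2⟩ := S.mem_closure_cone.1 hv
  have hm' : (m : ℝ) = 0 ∨ (m : ℝ) = 1 := mod_cast hm
  rw [S.bary_self, sign] at h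
  have hsum : (S.chart v).1 + (S.chart v).2 ≤ 0 := by
    rcases S.e_mem with he | he <;> rw [he] at h <;> push_cast at h <;>
      rcases hm' with hm | hm <;> linarith
  have h1' : (S.chart v).1 ≤ 0 := by linarith
  have h2' : (S.chart v).2 ≤ 0 := by linarith
  exact Prod.ext (h1'.antisymm h1) (h2'.antisymm h2)

theorem eq_of_isWall {a : Fin 3} {m : ℤ} (hm : m = 0 ∨ m = 1)
    (h : IsWall S.cone a (level a m)) : (a = S.γ + 1 ∨ a = S.γ + 2) ∧ m = S.e := by
  obtain ⟨p, d, hd, h⟩ := h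
  have h0 := h 0 le_rfl
  have h1 := h 1 zero_le_one
  rw [Set.mem_inter_iff, mem_hyperplane_level] at h0 h1
  have ha : a ≠ S.γ := by
    rintro rfl
    have heq := S.chart.injective <|
      (S.chart_eq_zero_of_mem_closure_cone h0.1.1 hm h0.2).trans
        (S.chart_eq_zero_of_mem_closure_cone h1.1.1 hm h1.2).symm
    rw [zero_smul, add_zero, one_smul, left_eq_add] at heq
    exact hd heq
  exact ⟨(eq_or_eq_add_one_or_eq_add_two a S.γ).resolve_left ha,
    S.eq_e_of_mem_closure_cone h0.1.1 ha hm h0.2⟩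

theorem sqrt_three_mul_cross_sub (p p' r r' : V) : √3 * cross (p - p') (r - r') =
    det (S.chart p - S.chart p') (S.chart r - S.chart r') := by
  simp only [sqrt_three_mul_cross S.γ, inner_sub_right, det, Prod.fst_sub, Prod.snd_sub,
    chart_fst, chart_snd, bary_apply]
  linear_combination (-((inner ℝ (grad (S.γ + 1)) p - inner ℝ (grad (S.γ + 1)) p') *
    (inner ℝ (grad (S.γ + 2)) r - inner ℝ (grad (S.γ + 2)) r') -
    (inner ℝ (grad (S.γ + 2)) p - inner ℝ (grad (S.γ + 2)) p') *
    (inner ℝ (grad (S.γ + 1)) r - inner ℝ (grad (S.γ + 1)) r'))) * S.cast_sign_mul_sign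

theorem cross_pos_iff {p p' r r' : V} : 0 < cross (p - p') (r - r') ↔
    0 < det (S.chart p - S.chart p') (S.chart r - S.chart r') := by
  rw [← S.sqrt_three_mul_cross_sub, mul_pos_iff_of_pos_left (by positivity)]

theorem infDist_lt_of_mem_cone {v : V} (hv : v ∈ S.cone) :
    Metric.infDist v (hyperplane S.γ (level S.γ (1 - S.e))) <
      Metric.infDist v (hyperplane S.γ (level S.γ S.e)) := by
  rw [infDist_hyperplane_level, infDist_hyperplane_level]
  refine div_lt_div_of_pos_right ?_ (by positivity)
  obtain ⟨h1, h2⟩ := S.mem_cone.1 hv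
  rw [S.bary_self, sign, ← sq_lt_sq]
  rcases S.e_mem with he | he <;> rw [he] <;> push_cast <;> nlinarith

theorem isFor_labels {w : W} (hw : center w ∈ S.cone) : S.labels.IsFor w where
  α_ne_β := (add_right_injective S.γ).ne (by decide)
  γ_ne_α := left_ne_add.2 (by decide)
  γ_ne_β := left_ne_add.2 (by decide)
  i_mem := level_eq_zero_or_one.2 S.e_mem
  j_mem := level_eq_zero_or_one.2 S.e_mem
  k_mem := level_eq_zero_or_one.2 (by have := S.e_mem; omega)
  wall_α := S.chamber_eq_cone hw ▸ S.isWall_add_one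
  wall_β := S.chamber_eq_cone hw ▸ S.isWall_add_two
  counterclockwise := by
    rw [S.chamber_eq_cone hw]
    refine ⟨S.chart.symm 0, ⟨mem_hyperplane_level.2 ?_, mem_hyperplane_level.2 ?_⟩, ?_⟩
    · rw [labels, ← chart_fst_eq_zero_iff, AffineEquiv.apply_symm_apply]; rfl
    · rw [labels, ← chart_snd_eq_zero_iff, AffineEquiv.apply_symm_apply]; rfl
    · rintro p ⟨hp, hp1⟩ hne
      have h1 : (S.chart p).1 = 0 := S.chart_fst_eq_zero_iff.2 (mem_hyperplane_level.1 hp1)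
      have h2 : (S.chart p).2 ≠ 0 := fun h2 =>
        hne ((S.chart.toEquiv.eq_symm_apply).2 (Prod.ext h1 h2))
      have hpos : 0 < (S.chart p).2 := (S.mem_closure_cone.1 hp.1).2.lt_of_ne' h2
      rw [S.cross_pos_iff, AffineEquiv.apply_symm_apply, sub_zero, sub_zero, det, h1, mul_zero,
        sub_zero]
      exact mul_pos (S.mem_cone.1 hw).1 hpos
  nearer := by
    have h := S.infDist_lt_of_mem_cone hw
    rwa [← sub_sub_cancel 1 S.e, level_one_sub S.γ (1 - S.e), sub_sub_cancel] at h

theorem not_counterclockwise_add_two {c v : V} (hc : c ∈ S.cone)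
    (hv : v ∈ hyperplane (S.γ + 2) (level (S.γ + 2) S.e) ∩
      hyperplane (S.γ + 1) (level (S.γ + 1) S.e)) :
    ¬ ∀ p ∈ frontier S.cone ∩ hyperplane (S.γ + 2) (level (S.γ + 2) S.e), p ≠ v →
      0 < cross (c - v) (p - v) := by
  intro h
  have hv0 : S.chart v = 0 := Prod.ext
    (S.chart_fst_eq_zero_iff.2 (mem_hyperplane_level.1 hv.2))
    (S.chart_snd_eq_zero_iff.2 (mem_hyperplane_level.1 hv.1))
  obtain ⟨p, hp⟩ := S.chart.surjective (1, 0)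
  have hpv : p ≠ v := by
    rintro rfl
    exact one_ne_zero (congrArg Prod.fst (hp.symm.trans hv0))
  have hpos := h p ⟨S.mem_frontier_cone.2 (.inl (by rw [hp]; simp)),
    mem_hyperplane_level.2 (S.chart_snd_eq_zero_iff.1 (by rw [hp]))⟩ hpv
  rw [S.cross_pos_iff, hv0, hp, sub_zero, sub_zero, det] at hpos
  linarith [(S.mem_cone.1 hc).2]

theorem eq_labels {w : W} (hw : center w ∈ S.cone) {d : Labels} (hd : d.IsFor w) :
    d = S.labels := by
  obtain ⟨α, i, β, j, γ, k⟩ := d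
  obtain ⟨hαβ, hγα, hγβ, hi, hj, hk, wα, wβ, ⟨v, hv, ccw⟩, near⟩ := hd
  dsimp only at *
  rw [S.chamber_eq_cone hw] at wα wβ ccw
  rw [← level_level α i] at hi wα hv ccw ⊢
  rw [← level_level β j] at hj wβ hv ⊢
  obtain ⟨hα, hie⟩ := S.eq_of_isWall (level_eq_zero_or_one.1 hi) wα
  obtain ⟨hβ, hje⟩ := S.eq_of_isWall (level_eq_zero_or_one.1 hj) wβ
  rw [hie] at hv ccw ⊢
  rw [hje] at hv ⊢
  obtain rfl : α = S.γ + 1 := by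
    refine hα.resolve_right fun hα => ?_
    obtain rfl : β = S.γ + 1 := hβ.resolve_right fun hβ => hαβ (hα.trans hβ.symm)
    subst hα
    exact S.not_counterclockwise_add_two hw hv ccw
  obtain rfl : β = S.γ + 2 := hβ.resolve_left hαβ.symm
  obtain rfl : γ = S.γ := by
    have hcases := eq_or_eq_add_one_or_eq_add_two γ S.γ
    tauto
  have hke : k ≠ level S.γ S.e := by
    rintro rfl
    have hlt := S.infDist_lt_of_mem_cone hw
    rw [level_one_sub] at hlt
    exact lt_asymm near hlt
  obtain rfl : k = level S.γ (1 - S.e) := by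
    have := (level_eq_zero_or_one (i := S.γ)).2 S.e_mem
    rw [level_one_sub]
    omega
  rfl

end Sector

theorem existsUnique_labels {w : W} (hw : ¬ IsSpiral w) : ∃! d : Labels, d.IsFor w := by
  obtain ⟨S, hS⟩ := Sector.exists_mem_cone fun h => hw (Set.mem_iUnion.1 h)
  exact ⟨S.labels, S.isFor_labels hS, fun d hd => S.eq_labels hS hd⟩

theorem mem_convexHull_triangle {a b c y : V} (hD : 0 < cross (b - a) (c - a))
    (h1 : 0 ≤ cross (b - a) (y - a)) (h2 : 0 ≤ cross (c - b) (y - b))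
    (h3 : 0 ≤ cross (a - c) (y - c)) : y ∈ convexHull ℝ {a, b, c} := by
  have hsum : cross (c - b) (y - b) + cross (a - c) (y - c) + cross (b - a) (y - a) =
      cross (b - a) (c - a) := by
    simp only [cross, PiLp.sub_apply]; ring
  have hy : cross (c - b) (y - b) • a + cross (a - c) (y - c) • b + cross (b - a) (y - a) • c =
      cross (b - a) (c - a) • y := by
    ext i
    simp only [PiLp.add_apply, PiLp.smul_apply, smul_eq_mul]
    fin_cases i <;> simp only [cross, PiLp.sub_apply, Fin.mk_zero, Fin.mk_one] <;> ring
  have hmem := Finset.centerMass_mem_convexHull (s := {a, b, c}) (R := ℝ) Finset.univ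
    (w := ![cross (c - b) (y - b), cross (a - c) (y - c), cross (b - a) (y - a)]) (z := ![a, b, c])
    (by intro i _; fin_cases i <;> assumption)
    (by simpa [Fin.sum_univ_three, hsum] using hD)
    (by intro i _; fin_cases i <;> simp)
  rw [Finset.centerMass] at hmem
  simpa [Fin.sum_univ_three, hsum, hy, hD.ne'] using hmem

theorem convex_setOf_cross_nonneg (a b : V) : Convex ℝ {y | 0 ≤ cross (b - a) (y - a)} := by
  intro u hu v hv s t hs ht hst
  have h : cross (b - a) (s • u + t • v - a) =
      s * cross (b - a) (u - a) + t * cross (b - a) (v - a) := by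
    obtain rfl : s = 1 - t := by linarith
    simp only [cross, PiLp.sub_apply, PiLp.add_apply, PiLp.smul_apply, smul_eq_mul]
    ring
  rw [Set.mem_ofPred_eq, h]
  exact add_nonneg (mul_nonneg hs hu) (mul_nonneg ht hv)

theorem cross_sub_rotate (a b c : V) : cross (b - a) (c - a) = cross (c - b) (a - b) := by
  simp only [cross, PiLp.sub_apply]; ring

theorem neg_cross_sub (a b c : V) : -cross (b - a) (c - a) = cross (a - b) (c - b) := by
  simp only [cross, PiLp.sub_apply]; ring

namespace IsConvexHexagon

variable {P : Fin 6 → V} (hP : IsConvexHexagon P) {y : V}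
include hP

theorem cross_nonneg_of_mem_convexHull (hy : y ∈ convexHull ℝ (Set.range P)) (m : Fin 6) :
    0 ≤ cross (P (m + 1) - P m) (y - P m) := by
  refine convexHull_min ?_ (convex_setOf_cross_nonneg (P m) (P (m + 1))) hy
  rintro _ ⟨n, rfl⟩
  by_cases h1 : n = m
  · simp [h1, cross]
  by_cases h2 : n = m + 1
  · simp [h2, cross, mul_comm]
  exact (hP m n h1 h2).le

theorem mem_convexHull_of_fan {m : Fin 6} (hm : 0 ≠ m) (hm' : 0 ≠ m + 1)
    (h1 : 0 ≤ cross (P m - P 0) (y - P 0)) (h2 : 0 ≤ cross (P (m + 1) - P m) (y - P m))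
    (h3 : cross (P (m + 1) - P 0) (y - P 0) ≤ 0) : y ∈ convexHull ℝ (Set.range P) := by
  have hsub : ({P 0, P m, P (m + 1)} : Set V) ⊆ Set.range P := by
    rintro _ (rfl | rfl | rfl) <;> exact ⟨_, rfl⟩
  refine convexHull_mono hsub (mem_convexHull_triangle ?_ h1 h2 ?_)
  · rw [cross_sub_rotate]
    exact hP m 0 hm hm'
  · rw [← neg_cross_sub]
    exact neg_nonneg.2 h3

/-- A point to the left of all edges lies in a triangle of the fan of diagonals from `P 0`. -/
theorem mem_convexHull_iff :
    y ∈ convexHull ℝ (Set.range P) ↔ ∀ m, 0 ≤ cross (P (m + 1) - P m) (y - P m) := by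
  refine ⟨hP.cross_nonneg_of_mem_convexHull, fun h => ?_⟩
  have h1 : 0 ≤ cross (P 1 - P 0) (y - P 0) := h 0
  have h5 : cross (P 5 - P 0) (y - P 0) ≤ 0 := by
    rw [← neg_nonneg, neg_cross_sub]
    exact h 5
  rcases le_total (cross (P 2 - P 0) (y - P 0)) 0 with h2 | h2
  · exact hP.mem_convexHull_of_fan (by decide) (by decide) h1 (h 1) h2
  rcases le_total (cross (P 3 - P 0) (y - P 0)) 0 with h3 | h3
  · exact hP.mem_convexHull_of_fan (by decide) (by decide) h2 (h 2) h3
  rcases le_total (cross (P 4 - P 0) (y - P 0)) 0 with h4 | h4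
  · exact hP.mem_convexHull_of_fan (by decide) (by decide) h3 (h 3) h4
  · exact hP.mem_convexHull_of_fan (by decide) (by decide) h4 (h 4) h5

end IsConvexHexagon

/-- The reflections of the plane in the coordinates `Sector.pos`: `mirror 0 n`, `mirror 1 n` and
`mirror 2 n` fix the points `p` with `p.1 + p.2 = n`, `p.1 = n` and `p.2 = n`, respectively. -/
def mirror : Fin 3 → ℤ → ℤ × ℤ → ℤ × ℤ
  | 0, n, p => (n - p.2, n - p.1)
  | 1, n, p => (2 * n - p.1, p.1 + p.2 - n)
  | 2, n, p => (p.1 + p.2 - n, 2 * n - p.2)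

/-- `MirrorOutward c i n p` says that `mirror i n` moves `p` away from the `i`-th fundamental root
strip; for the coordinates `S.pos` one takes `c = 3 * S.e`. -/
def MirrorOutward (c : ℤ) : Fin 3 → ℤ → ℤ × ℤ → Prop
  | 0, n, p => Outward (-c) (p.1 + p.2) n
  | 1, n, p => Outward 0 p.1 n
  | 2, n, p => Outward 0 p.2 n

/-- The closed hexagon with the vertices `hexVertex c U V`. -/
def InHex (c U V : ℤ) (p : ℤ × ℤ) : Prop :=
  (-(2 * U + V + 3 * c) ≤ p.1 + 2 * p.2 ∧ p.1 + 2 * p.2 ≤ U + 2 * V) ∧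
  (-(U + 2 * V + 3 * c) ≤ 2 * p.1 + p.2 ∧ 2 * p.1 + p.2 ≤ 2 * U + V) ∧
  -(2 * U + V) ≤ p.1 - p.2 ∧ p.1 - p.2 ≤ U + 2 * V

theorem InHex.of_mirror {c U V : ℤ} (hc : 0 ≤ c) (hc' : c ≤ 3) {p : ℤ × ℤ} {i : Fin 3} {n : ℤ}
    (ho : MirrorOutward c i n p) (h : InHex c U V (mirror i n p)) : InHex c U V p := by
  fin_cases i <;> simp only [MirrorOutward, Outward, mirror, InHex] at * <;> omega

/-- If `(u, v) ≠ (U, V)`, then one of the next lines beyond `(u, v)`, at distance `u % 3` or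
`3 - u % 3`, reflects `(u, v)` to a point that is still bounded by `(U, V)`. -/
theorem exists_room {U V u v : ℤ} (hUV : U % 3 = V % 3) (hU0 : U % 3 ≠ 0) (huv : u % 3 = v % 3)
    (hu0 : u % 3 ≠ 0) (hne : ¬ (u = U ∧ v = V)) (h1 : 2 * u + v ≤ 2 * U + V)
    (h2 : u + 2 * v ≤ U + 2 * V) :
    2 * u + v + 3 * (u % 3) ≤ 2 * U + V ∧ u + 2 * v + 3 * (u % 3) ≤ U + 2 * V ∨
      2 * u + v + 3 * (3 - u % 3) ≤ 2 * U + V ∨ u + 2 * v + 3 * (3 - u % 3) ≤ U + 2 * V := by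
  obtain ⟨a, ha⟩ : 3 ∣ 2 * U + V - (2 * u + v) := by omega
  obtain ⟨b, hb⟩ : 3 ∣ U + 2 * V - (u + 2 * v) := by omega
  have hab : a ≠ 0 ∨ b ≠ 0 := by omega
  obtain hr | hr : u % 3 = 1 ∨ u % 3 = 2 := by omega
  all_goals rw [hr]
  · by_contra! hroom
    have : (a = 0 ∧ b = 1) ∨ (a = 1 ∧ b = 0) := by omega
    omega
  · omega

theorem InHex.exists_mirrorOutward_of_pos {c U V : ℤ} (hc : 0 ≤ c) (hU : 0 < U) (hV : 0 < V)
    (hUV : U % 3 = V % 3) (hU0 : U % 3 ≠ 0) {u v : ℤ} (hu : 0 < u) (hv : 0 < v)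
    (huv : u % 3 = v % 3) (hu0 : u % 3 ≠ 0) (hne : ¬ (u = U ∧ v = V)) (h : InHex c U V (u, v)) :
    ∃ i n, 3 ∣ n ∧ MirrorOutward c i n (u, v) ∧ InHex c U V (mirror i n (u, v)) := by
  have hroom := exists_room hUV hU0 huv hu0 hne h.2.1.2 h.1.2
  unfold InHex at h
  dsimp only at h
  rcases hroom with hroom | hroom | hroom
  · refine ⟨0, u + v + u % 3, by omega, .inl ⟨by omega, by omega⟩, ?_⟩
    simp only [mirror, InHex]
    omega
  · refine ⟨1, u + (3 - u % 3), by omega, .inl ⟨by omega, by omega⟩, ?_⟩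
    simp only [mirror, InHex]
    omega
  · refine ⟨2, v + (3 - u % 3), by omega, .inl ⟨by omega, by omega⟩, ?_⟩
    simp only [mirror, InHex]
    omega

theorem InHex.exists_mirrorOutward {c U V : ℤ} (hc : c = 0 ∨ c = 3) (hU : 0 < U) (hV : 0 < V)
    (hUV : U % 3 = V % 3) (hU0 : U % 3 ≠ 0) {p : ℤ × ℤ} (hp : p.1 % 3 = p.2 % 3)
    (hp0 : p.1 % 3 ≠ 0) (hne : p ≠ (U, V)) (h : InHex c U V p) :
    ∃ i n, 3 ∣ n ∧ MirrorOutward c i n p ∧ InHex c U V (mirror i n p) := by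
  obtain ⟨u, v⟩ := p
  rw [Ne, Prod.mk_inj] at hne
  by_cases hpos : 0 < u ∧ 0 < v
  · exact h.exists_mirrorOutward_of_pos (by omega) hU hV hUV hU0 hpos.1 hpos.2 hp hp0 hne
  unfold InHex at h
  dsimp only at hp hp0 h
  by_cases hs : u + v < -c
  · exact ⟨0, -c, by omega, .inl ⟨hs, le_rfl⟩, by simp only [mirror, InHex]; omega⟩
  by_cases hs' : u + v < 0
  · refine ⟨0, 0, by omega, .inl ⟨hs', by omega⟩, ?_⟩
    simp only [mirror, InHex]
    obtain rfl := hc.resolve_left (by omega)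
    have : u + v = -1 ∨ u + v = -2 := by omega
    omega
  obtain hu | hv : u < 0 ∨ v < 0 := by omega
  · exact ⟨1, 0, by omega, .inl ⟨hu, le_rfl⟩, by simp only [mirror, InHex]; omega⟩
  · exact ⟨2, 0, by omega, .inl ⟨hv, le_rfl⟩, by simp only [mirror, InHex]; omega⟩

/-- The vertices of the hexagon of an element `w`, in the coordinates `S.pos` of its chamber `S`,
where `S.pos w = (U, V)` and `c = 3 * S.e`. -/
def hexVertex (c U V : ℤ) : Fin 6 → ℤ × ℤ :=
  ![(U, V), (-U, U + V), (-c - U - V, U - c), (-c - V, -c - U), (V - c, -c - U - V), (U + V, -V)]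

/-- The lengths of the sides of the hexagon with the vertices `hexVertex c U V`, up to a factor. -/
def hexWidth (c U V : ℤ) : Fin 6 → ℤ := ![U, V + c, U, V, U + c, V]

/-- The affine forms that vanish on the sides of the hexagon with the vertices `hexVertex c U V` and
are positive inside it. -/
def hexSide (c U V : ℤ) (p : ℤ × ℤ) : Fin 6 → ℤ :=
  ![U + 2 * V - (p.1 + 2 * p.2), p.1 - p.2 + (2 * U + V), 2 * p.1 + p.2 + (U + 2 * V + 3 * c),
    p.1 + 2 * p.2 + (2 * U + V + 3 * c), U + 2 * V - (p.1 - p.2), 2 * U + V - (2 * p.1 + p.2)]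

theorem det_hexVertex (c U V : ℤ) (p : ℤ × ℤ) (m : Fin 6) :
    det (hexVertex c U V (m + 1) - hexVertex c U V m) (p - hexVertex c U V m) =
      hexWidth c U V m * hexSide c U V p m := by
  fin_cases m <;> simp [det, hexVertex, hexWidth, hexSide] <;> ring

theorem inHex_iff {c U V : ℤ} {p : ℤ × ℤ} : InHex c U V p ↔ ∀ m, 0 ≤ hexSide c U V p m := by
  simp only [Fin.forall_fin_succ, InHex, hexSide]
  simp
  omega

section

variable {c U V : ℤ} (hc : 0 ≤ c) (hU : 0 < U) (hV : 0 < V)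
include hc hU hV

theorem hexWidth_pos (m : Fin 6) : 0 < hexWidth c U V m := by
  fin_cases m <;> simp [hexWidth] <;> omega

theorem hexSide_hexVertex_pos {m n : Fin 6} (hm : n ≠ m) (hm' : n ≠ m + 1) :
    0 < hexSide c U V (hexVertex c U V n) m := by
  fin_cases m <;> fin_cases n <;> first | exact absurd rfl hm | exact absurd rfl hm' |
    (simp [hexSide, hexVertex]; omega)

theorem det_hexVertex_pos {m n : Fin 6} (hm : n ≠ m) (hm' : n ≠ m + 1) :
    0 < det (hexVertex c U V (m + 1) - hexVertex c U V m)
      (hexVertex c U V n - hexVertex c U V m) := by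
  rw [det_hexVertex]
  exact mul_pos (hexWidth_pos hc hU hV m) (hexSide_hexVertex_pos hc hU hV hm hm')

theorem inHex_iff_det_nonneg {p : ℤ × ℤ} : InHex c U V p ↔
    ∀ m, 0 ≤ det (hexVertex c U V (m + 1) - hexVertex c U V m) (p - hexVertex c U V m) := by
  simp only [inHex_iff, det_hexVertex, mul_nonneg_iff_of_pos_left (hexWidth_pos hc hU hV _)]

end

namespace Sector

variable (S : Sector)

/-- The coordinates `S.chart` of the alcove center of `w`, scaled by `3` to be integers. -/
def pos (w : W) : ℤ × ℤ :=
  (S.sign * (coord w (S.γ + 1) - 3 * S.e), S.sign * (coord w (S.γ + 2) - 3 * S.e))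

theorem sign_ne_zero : S.sign ≠ 0 := left_ne_zero_of_mul_eq_one S.sign_mul_sign

theorem pos_injective : Function.Injective S.pos := by
  intro u w h
  rw [pos, pos, Prod.mk_inj] at h
  exact eq_of_coord S.γ (sub_left_injective (mul_left_cancel₀ S.sign_ne_zero h.1))
    (sub_left_injective (mul_left_cancel₀ S.sign_ne_zero h.2))

theorem pos_fst_cast (w : W) : ((S.pos w).1 : ℝ) = 3 * (S.chart (center w)).1 := by
  rw [pos, chart_fst]
  push_cast
  rw [coord_cast]
  ring

theorem pos_snd_cast (w : W) : ((S.pos w).2 : ℝ) = 3 * (S.chart (center w)).2 := by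
  rw [pos, chart_snd]
  push_cast
  rw [coord_cast]
  ring

theorem nine_mul_sqrt_three_mul_cross (x x' y y' : W) :
    9 * √3 * cross (center x - center x') (center y - center y') =
      (det (S.pos x - S.pos x') (S.pos y - S.pos y') : ℤ) := by
  rw [mul_assoc, S.sqrt_three_mul_cross_sub]
  simp only [det, Prod.fst_sub, Prod.snd_sub]
  push_cast
  simp only [pos_fst_cast, pos_snd_cast]
  ring

theorem cross_center_pos_iff {x x' y y' : W} :
    0 < cross (center x - center x') (center y - center y') ↔
      0 < det (S.pos x - S.pos x') (S.pos y - S.pos y') := by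
  rw [← mul_pos_iff_of_pos_left (show 0 < 9 * √3 by positivity), S.nine_mul_sqrt_three_mul_cross,
    Int.cast_pos]

theorem cross_center_nonneg_iff {x x' y y' : W} :
    0 ≤ cross (center x - center x') (center y - center y') ↔
      0 ≤ det (S.pos x - S.pos x') (S.pos y - S.pos y') := by
  rw [← mul_nonneg_iff_of_pos_left (show 0 < 9 * √3 by positivity),
    S.nine_mul_sqrt_three_mul_cross, Int.cast_nonneg_iff]

theorem pos_pos_of_mem_cone {w : W} (hw : center w ∈ S.cone) :
    0 < (S.pos w).1 ∧ 0 < (S.pos w).2 := by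
  rify
  rw [pos_fst_cast, pos_snd_cast]
  exact ⟨mul_pos three_pos (S.mem_cone.1 hw).1, mul_pos three_pos (S.mem_cone.1 hw).2⟩

theorem sign_eq : (S.e = 0 ∧ S.sign = -1) ∨ (S.e = 1 ∧ S.sign = 1) := by
  unfold sign
  have := S.e_mem
  omega

theorem pos_emod (w : W) : (S.pos w).1 % 3 = (S.pos w).2 % 3 := by
  have := coord_emod w (S.γ + 1) (S.γ + 2)
  unfold pos
  obtain ⟨he, hs⟩ | ⟨he, hs⟩ := S.sign_eq <;> simp only [he, hs] <;> omega

theorem pos_emod_ne (w : W) : (S.pos w).1 % 3 ≠ 0 := by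
  have := coord_emod_ne w (S.γ + 1)
  unfold pos
  obtain ⟨he, hs⟩ | ⟨he, hs⟩ := S.sign_eq <;> simp only [he, hs] <;> omega

/-- The line `bary (S.γ + i) = m` is the fixed line of `mirror i (S.wall i m)` in the coordinates
`S.pos`. -/
def wall : Fin 3 → ℤ → ℤ
  | 0, m => S.sign * (3 - 3 * m - 6 * S.e)
  | _, m => S.sign * (3 * m - 3 * S.e)

theorem exists_wall_eq (i : Fin 3) {n : ℤ} (hn : 3 ∣ n) : ∃ m, S.wall i m = n := by
  obtain ⟨k, rfl⟩ := hn
  have hs := S.sign_mul_sign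
  fin_cases i
  · exact ⟨1 - 2 * S.e - S.sign * k, by change S.sign * _ = _; linear_combination 3 * k * hs⟩
  all_goals exact ⟨S.e + S.sign * k, by simp only [wall]; linear_combination 3 * k * hs⟩

theorem pos_baryRefl (i : Fin 3) (m : ℤ) (w : W) :
    S.pos (baryRefl (S.γ + i) m * w) = mirror i (S.wall i m) (S.pos w) := by
  have hsum := coord_add w S.γ
  have h12 : S.γ + 1 ≠ S.γ + 2 := (add_right_injective S.γ).ne (by decide)
  fin_cases i <;> simp only [Fin.zero_eta, Fin.mk_one, Fin.reduceFinMk, add_zero, pos, wall, mirror]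
  · rw [coord_baryRefl_of_ne (add_ne_left.2 (by decide)),
      coord_baryRefl_of_ne (add_ne_left.2 (by decide)), Prod.mk_inj]
    constructor <;> linear_combination S.sign * hsum
  · rw [coord_baryRefl_self, coord_baryRefl_of_ne h12.symm, Prod.mk_inj]
    constructor <;> ring
  · rw [coord_baryRefl_self, coord_baryRefl_of_ne h12, Prod.mk_inj]
    constructor <;> ring

theorem mirrorOutward_wall_iff {i : Fin 3} {m : ℤ} {w : W} :
    MirrorOutward (3 * S.e) i (S.wall i m) (S.pos w) ↔ Outward 3 (coord w (S.γ + i)) (3 * m) := by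
  have hsum := coord_add w S.γ
  fin_cases i <;> simp only [Fin.zero_eta, Fin.mk_one, Fin.reduceFinMk, add_zero, pos, wall,
    MirrorOutward, Outward] <;>
    obtain ⟨he, hs⟩ | ⟨he, hs⟩ := S.sign_eq <;> simp only [he, hs] <;> omega

theorem pos_vertex (w : W) (m : Fin 6) :
    S.pos (S.labels.vertex w m) = hexVertex (3 * S.e) (S.pos w).1 (S.pos w).2 m := by
  have hvertex : S.labels.vertex w = ![w, baryRefl (S.γ + 1) S.e * w,
      baryRefl S.γ (1 - S.e) * (baryRefl (S.γ + 1) S.e * w), baryRefl S.γ (1 - S.e) * w,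
      baryRefl S.γ (1 - S.e) * (baryRefl (S.γ + 2) S.e * w), baryRefl (S.γ + 2) S.e * w] := rfl
  have h0 : ∀ x, S.pos (baryRefl S.γ (1 - S.e) * x) = mirror 0 (-(3 * S.e)) (S.pos x) := by
    have hwall : S.wall 0 (1 - S.e) = -(3 * S.e) := by
      unfold wall
      obtain ⟨he, hs⟩ | ⟨he, hs⟩ := S.sign_eq <;> rw [he, hs] <;> rfl
    intro x
    rw [← hwall, ← pos_baryRefl, add_zero]
  have h1 : ∀ x, S.pos (baryRefl (S.γ + 1) S.e * x) = mirror 1 0 (S.pos x) := fun x => by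
    rw [pos_baryRefl, wall, sub_self, mul_zero]; decide
  have h2 : ∀ x, S.pos (baryRefl (S.γ + 2) S.e * x) = mirror 2 0 (S.pos x) := fun x => by
    rw [pos_baryRefl, wall, sub_self, mul_zero]; decide
  rw [hvertex]
  fin_cases m <;> simp [hexVertex, h0, h1, h2, mirror] <;> ring_nf <;> trivial

theorem inHex_pos_self {w : W} (hw : center w ∈ S.cone) :
    InHex (3 * S.e) (S.pos w).1 (S.pos w).2 (S.pos w) := by
  have := S.pos_pos_of_mem_cone hw
  have := S.e_mem
  unfold InHex
  omega

theorem sep_le_of_inHex {U V : ℤ} {x : W} (h : InHex (3 * S.e) U V (S.pos x)) :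
    sep x ≤ (6 * (U + V + 9)).toNat := by
  have hsum := coord_add x S.γ
  rw [sep, sum_eq_rotate _ S.γ]
  unfold strip
  unfold InHex pos at h
  obtain ⟨he, hs⟩ | ⟨he, hs⟩ := S.sign_eq <;> simp only [he, hs] at h <;> omega

theorem bruhatLE_iff_inHex {w : W} (hw : center w ∈ S.cone) (x : W) :
    BruhatLE x w ↔ InHex (3 * S.e) (S.pos w).1 (S.pos w).2 (S.pos x) := by
  have he := S.e_mem
  have hpos := S.pos_pos_of_mem_cone hw
  refine bruhatLE_iff_of_steps (S := fun x => InHex (3 * S.e) (S.pos w).1 (S.pos w).2 (S.pos x))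
    (S.inHex_pos_self hw) (fun x i m ho h => ?_) (fun x h hxw => ?_)
    (fun _ => S.sep_le_of_inHex) x
  · rw [← add_sub_cancel S.γ i] at ho h
    rw [pos_baryRefl] at h
    exact h.of_mirror (by omega) (by omega) (S.mirrorOutward_wall_iff.2 ho)
  · obtain ⟨i, n, hn, ho, h⟩ := h.exists_mirrorOutward (by omega) hpos.1 hpos.2 (S.pos_emod w)
      (S.pos_emod_ne w) (S.pos_emod x) (S.pos_emod_ne x) (S.pos_injective.ne hxw)
    obtain ⟨m, rfl⟩ := S.exists_wall_eq i hn
    exact ⟨S.γ + i, m, S.mirrorOutward_wall_iff.1 ho, by rwa [pos_baryRefl]⟩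

theorem isConvexHexagon {w : W} (hw : center w ∈ S.cone) :
    IsConvexHexagon fun m => center (S.labels.vertex w m) := by
  have he := S.e_mem
  have hpos := S.pos_pos_of_mem_cone hw
  intro m n hm hm'
  rw [S.cross_center_pos_iff]
  simp only [pos_vertex]
  exact det_hexVertex_pos (by omega) hpos.1 hpos.2 hm hm'

theorem center_mem_hexagon_iff {w : W} (hw : center w ∈ S.cone) {x : W} :
    center x ∈ S.labels.hexagon w ↔ InHex (3 * S.e) (S.pos w).1 (S.pos w).2 (S.pos x) := by
  have he := S.e_mem
  have hpos := S.pos_pos_of_mem_cone hw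
  rw [Labels.hexagon, (S.isConvexHexagon hw).mem_convexHull_iff,
    inHex_iff_det_nonneg (by omega) hpos.1 hpos.2]
  simp only [S.cross_center_nonneg_iff, pos_vertex]

end Sector

end

end AffineA2

/-- For a non-spiral `w`, the three hyperplanes that define its hexagon exist and are unique, the
six points obtained from them are the vertices of a convex hexagon in counterclockwise order, and
`x ≤ w` holds exactly when the alcove center of `x` lies on or inside this hexagon. -/
theorem theoremt (w : AffineA2.W) (hw : ¬ AffineA2.IsSpiral w) :
    (∃! d : AffineA2.Labels, d.IsFor w) ∧
    ∀ d : AffineA2.Labels, d.IsFor w →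
      AffineA2.IsConvexHexagon (fun m => AffineA2.center (d.vertex w m)) ∧
      {x : AffineA2.W | AffineA2.BruhatLE x w} =
        {x : AffineA2.W | AffineA2.center x ∈ d.hexagon w} := by
  refine ⟨AffineA2.existsUnique_labels hw, fun d hd => ?_⟩
  obtain ⟨S, hS⟩ := AffineA2.Sector.exists_mem_cone fun h => hw (Set.mem_iUnion.1 h)
  obtain rfl := S.eq_labels hS hd
  refine ⟨S.isConvexHexagon hS, Set.ext fun x => ?_⟩
  exact (S.bruhatLE_iff_inHex hS x).trans (S.center_mem_hexagon_iff hS).symm
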